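/- Let $0\le m\le q$ and $0\le n\le p$. The Meijer $G$-function is defined by the Mellin--Barnes integral $$G^{m,n}_{p,q}\left[z\,\middle|\,\begin{matrix}\alpha_1,\ldots,\alpha_p\\ \beta_1,\ldots,\beta_q\end{matrix}\right]=\frac1{2\pi i}\int_{\gamma-i\infty}^{\gamma+i\infty}\frac{\prod_{j=1}^m\Gamma(\beta_j+s)\prod_{j=1}^n\Gamma(1-\alpha_j-s)}{\prod_{j=m+1}^q\Gamma(1-\beta_j-s)\prod_{j=n+1}^p\Gamma(\alpha_j+s)}\,z^{-s}\,ds ,$$ where the line $\Re s=\gamma$ has the poles of $\Gamma(\beta_j+s)$, $1\le j\le m$, on its left and the poles of $\Gamma(1-\alpha_j-s)$, $1\le j\le n$, on its right. The e.p. (existence and positivity) conditions for indexes $m',n',p',q'$ and real parameters $(\alpha'_j,A'_j)_{1}^{p'}$, $(\beta'_j,B'_j)_{1}^{q'}$ require that there are integers $n_1,n_2,n_3,n_4\ge 0$, with $n_1\ge1$ or $n_3\ge1$, such that $m'=n_1+n_2+n_3$, $n'=n_3+n_4$, $p'=n_2+n_3+n_4$, $q'=n_1+n_2+n_3+n_4$,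 and real numbers $a_j>0$, $b_j\ge0$ $(1\le j\le n_1)$; $a'_j>0$, $c_j\ge0$, $d_j\ge c_j+1$ $(1\le j\le n_2)$; $a''_j,r_j>0$, $o_j\ge0$ $(1\le j\le n_3)$; $a'''_j,v_j>0$, $w_j\ge v_j+1$ $(1\le j\le n_4)$, with, as ordered lists, $$(\alpha'_j,A'_j)_1^{p'}=(1-r_j,a''_j)_1^{n_3},(1-v_j,a'''_j)_1^{n_4},(d_j,a'_j)_1^{n_2},$$ $$(\beta'_j,B'_j)_1^{q'}=(b_j,a_j)_1^{n_1},(c_j,a'_j)_1^{n_2},(o_j,a''_j)_1^{n_3},(1-w_j,a'''_j)_1^{n_4},$$ and that $A'_j(\beta'_{j'}+l)\ne B'_{j'}(\alpha'_j-l'-1)$ for all $1\le j\le n'$, $1\le j'\le m'$ and all integers $l,l'\ge0$. If the e.p. conditions hold for $m',n',p',q'$ and parameters $\alpha'_1,\ldots,\alpha'_{p'}$, $\beta'_1,\ldots,\beta'_{q'}$, $A'_1=\cdots=A'_{p'}=B'_1=\cdots=B'_{q'}=\lambda$ for some $\lambda>0$, then, for all $\omega,t>0$ and for either choice of the sign (the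 same in all places), the Meijer $G$-function $$G^{m',n'}_{p',q'}\left[t\,\middle|\,\begin{matrix}\alpha'_1\pm\omega,\ldots,\alpha'_{p'}\pm\omega\\ \beta'_1\pm\omega,\ldots,\beta'_{q'}\pm\omega\end{matrix}\right]$$ exists (a line as above exists, and on each such line the integral converges absolutely, to the same value) and is positive. -/

import Mathlib

open MeasureTheory

noncomputable section

/-- The Mellin-Barnes kernel `Ξ^{m,n}_{p,q}(s)` of the Fox `H`-function,
`∏_{j ≤ m} Γ(β_j + B_j s) ∏_{j ≤ n} Γ(1 - α_j - A_j s)` divided by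
`∏_{j > m} Γ(1 - β_j - B_j s) ∏_{j > n} Γ(α_j + A_j s)`.
The parameters are numbered from `0`, so the first `m` of them are those with index `< m`.
At the poles of a Gamma function of the denominator both `Complex.Gamma` and the quotient are `0`,
which is the value of the entire function `1 / Γ` there. -/
def foxKernel (m n : ℕ) {p q : ℕ} (α : Fin p → ℂ) (A : Fin p → ℝ) (β : Fin q → ℂ)
    (B : Fin q → ℝ) (s : ℂ) : ℂ :=
  ((∏ j ∈ Finset.univ.filter (fun j : Fin q => (j : ℕ) < m), Complex.Gamma (β j + B j * s)) *
      ∏ j ∈ Finset.univ.filter (fun j : Fin p => (j : ℕ) < n), Complex.Gamma (1 - α j - A j * s)) /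
    ((∏ j ∈ Finset.univ.filter (fun j : Fin q => m ≤ (j : ℕ)), Complex.Gamma (1 - β j - B j * s)) *
      ∏ j ∈ Finset.univ.filter (fun j : Fin p => n ≤ (j : ℕ)), Complex.Gamma (α j + A j * s))

/-- The vertical line `Re s = γ` separates the poles `-(β_j + l) / B_j`, `j ≤ m`, of the functions
`Γ(β_j + B_j s)`, which lie to its left, from the poles `(1 - α_j + l) / A_j`, `j ≤ n`, of the
functions `Γ(1 - α_j - A_j s)`, which lie to its right. -/
def SeparatesPoles (m n : ℕ) {p q : ℕ} (α : Fin p → ℂ) (A : Fin p → ℝ) (β : Fin q → ℂ)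
    (B : Fin q → ℝ) (γ : ℝ) : Prop :=
  (∀ j : Fin q, (j : ℕ) < m → ∀ l : ℕ, (-(β j + l) / B j).re < γ) ∧
    ∀ j : Fin p, (j : ℕ) < n → ∀ l : ℕ, γ < ((1 - α j + l) / A j).re

/-- The integrand `Ξ(s) z^{-s}` at the point `s = γ + i y` of the line `Re s = γ`. -/
def mellinBarnesIntegrand (m n : ℕ) {p q : ℕ} (α : Fin p → ℂ) (A : Fin p → ℝ) (β : Fin q → ℂ)
    (B : Fin q → ℝ) (z : ℂ) (γ : ℝ) (y : ℝ) : ℂ :=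
  foxKernel m n α A β B (γ + y * Complex.I) * z ^ (-((γ : ℂ) + y * Complex.I))

/-- `(2 π i)⁻¹ ∫ Ξ(s) z^{-s} ds` along the line `Re s = γ`, from `γ - i ∞` to `γ + i ∞`
(where `ds = i dy`). -/
def mellinBarnesIntegral (m n : ℕ) {p q : ℕ} (α : Fin p → ℂ) (A : Fin p → ℝ) (β : Fin q → ℂ)
    (B : Fin q → ℝ) (z : ℂ) (γ : ℝ) : ℂ :=
  1 / (2 * Real.pi * Complex.I) *
    ∫ y : ℝ, mellinBarnesIntegrand m n α A β B z γ y * Complex.I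

open Classical in
/-- The Fox `H`-function `H^{m,n}_{p,q}[z | (α_j, A_j); (β_j, B_j)]`, for parameters such that
some vertical line separates the poles: the Mellin-Barnes integral along such a line. -/
def foxH (m n : ℕ) {p q : ℕ} (α : Fin p → ℂ) (A : Fin p → ℝ) (β : Fin q → ℂ)
    (B : Fin q → ℝ) (z : ℂ) : ℂ :=
  if h : ∃ γ : ℝ, SeparatesPoles m n α A β B γ then
    mellinBarnesIntegral m n α A β B z h.choose
  else 0

/-- The Mellin-Barnes definition of `H` makes sense at `z`: there is a separating line, and on
every separating line the integral converges absolutely and has the same value `foxH … z`. -/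
def FoxHExists (m n : ℕ) {p q : ℕ} (α : Fin p → ℂ) (A : Fin p → ℝ) (β : Fin q → ℂ)
    (B : Fin q → ℝ) (z : ℂ) : Prop :=
  (∃ γ : ℝ, SeparatesPoles m n α A β B γ) ∧
    ∀ γ : ℝ, SeparatesPoles m n α A β B γ →
      Integrable (mellinBarnesIntegrand m n α A β B z γ) ∧
        mellinBarnesIntegral m n α A β B z γ = foxH m n α A β B z

/-- The Meijer `G`-function `G^{m,n}_{p,q}[z | α_1, …, α_p; β_1, …, β_q]`: the Fox `H`-function
whose scale parameters are all equal to `1`. -/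
def meijerG (m n : ℕ) {p q : ℕ} (α : Fin p → ℂ) (β : Fin q → ℂ) (z : ℂ) : ℂ :=
  foxH m n α (fun _ => 1) β (fun _ => 1) z

/-- The Mellin-Barnes definition of `G` makes sense at `z`. -/
def MeijerGExists (m n : ℕ) {p q : ℕ} (α : Fin p → ℂ) (β : Fin q → ℂ) (z : ℂ) : Prop :=
  FoxHExists m n α (fun _ => 1) β (fun _ => 1) z

/-- The e.p. (existence and positivity) conditions for the indexes `m, n, p, q` and the real
parameters `(α_j, A_j)_1^p`, `(β_j, B_j)_1^q`. The scale parameters usually written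
`a, a', a'', a'''` are `a₁, a₂, a₃, a₄` here. -/
def EPConditions (m n : ℕ) {p q : ℕ} (α A : Fin p → ℝ) (β B : Fin q → ℝ) : Prop :=
  ∃ (n₁ n₂ n₃ n₄ : ℕ) (a₁ b : Fin n₁ → ℝ) (a₂ c d : Fin n₂ → ℝ) (a₃ o r : Fin n₃ → ℝ)
    (a₄ v w : Fin n₄ → ℝ),
    (∀ j, 0 < a₁ j ∧ 0 ≤ b j) ∧
    (∀ j, 0 < a₂ j ∧ 0 ≤ c j ∧ c j + 1 ≤ d j) ∧
    (∀ j, 0 < a₃ j ∧ 0 < r j ∧ 0 ≤ o j) ∧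
    (∀ j, 0 < a₄ j ∧ 0 < v j ∧ v j + 1 ≤ w j) ∧
    (m = n₁ + n₂ + n₃ ∧ n = n₃ + n₄ ∧ p = n₂ + n₃ + n₄ ∧ q = n₁ + n₂ + n₃ + n₄) ∧
    (1 ≤ n₁ ∨ 1 ≤ n₃) ∧
    (List.ofFn (fun j => (α j, A j)) =
      List.ofFn (fun j => (1 - r j, a₃ j)) ++ List.ofFn (fun j => (1 - v j, a₄ j)) ++
        List.ofFn (fun j => (d j, a₂ j))) ∧
    (List.ofFn (fun j => (β j, B j)) =
      List.ofFn (fun j => (b j, a₁ j)) ++ List.ofFn (fun j => (c j, a₂ j)) ++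
        List.ofFn (fun j => (o j, a₃ j)) ++ List.ofFn (fun j => (1 - w j, a₄ j))) ∧
    ∀ j : Fin p, (j : ℕ) < n → ∀ k : Fin q, (k : ℕ) < m → ∀ l l' : ℕ,
      A j * (β k + l) ≠ B k * (α j - l' - 1)

end

/-! After a shift of all parameters by a real `ε`, the kernel is a product of factors `Γ(b+ε+s)`,
`Γ(o+ε+s)`, `Γ(c+ε+s)/Γ(d+ε+s)`, `Γ(r-ε-s)` and `Γ(v-ε-s)/Γ(w-ε-s)`. One factor of the first two
kinds is the Mellin transform of the positive function `x^(b+ε) e^(-x)` or its analogue with `o`,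
and Mellin inversion recovers that function (`hasPosMellinInv_Gamma`). Every other factor is an
integral of powers `X^s` against a positive weight: Euler's integral for a Gamma factor, the Beta
integral for a quotient, and `1/X` in place of `X` when `s` enters with a minus sign.

Multiplying the kernel by such a factor turns the inverse transform `F(t)` into the multiplicative
convolution `∫ g F(t/X) dμ`, which is again positive (`HasPosMellinInv.mul`). Induction over the
factors gives the theorem. Since the resulting function never mentions the line, independence of the
line needs no contour shift. -/

/-- The inverse Mellin transform of `K` converges absolutely on each line `Re s = σ`, `σ ∈ I`,
and has a positive value on `(0, ∞)` that does not depend on `σ`. -/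
def HasPosMellinInv (K : ℂ → ℂ) (I : Set ℝ) : Prop :=
  ∃ F : ℝ → ℝ, (∀ t, 0 < t → 0 < F t) ∧
    ∀ σ ∈ I, Complex.VerticalIntegrable K σ ∧ ∀ t, 0 < t → mellinInv σ K t = F t

/-- On the strip `Re s ∈ I`, `K` is an absolutely convergent integral of powers `X ^ s` of a
positive function `X`, with a positive weight. -/
def IsPosPowerIntegral (K : ℂ → ℂ) (I : Set ℝ) : Prop :=
  ∃ (μ : Measure ℝ) (g X : ℝ → ℝ), SFinite μ ∧ μ ≠ 0 ∧ Measurable g ∧ Measurable X ∧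
    (∀ᵐ a ∂μ, 0 < g a ∧ 0 < X a) ∧
    ∀ s : ℂ, s.re ∈ I → Integrable (fun a => (g a : ℂ) * (X a : ℂ) ^ s) μ ∧
      ∫ a, (g a : ℂ) * (X a : ℂ) ^ s ∂μ = K s

/-! ### Positive power integrals and multiplicative convolution -/

lemma IsPosPowerIntegral.mono {K : ℂ → ℂ} {I J : Set ℝ} (h : IsPosPowerIntegral K I)
    (hJ : J ⊆ I) : IsPosPowerIntegral K J := by
  obtain ⟨μ, g, X, h1, h2, h3, h4, h5, h6⟩ := h
  exact ⟨μ, g, X, h1, h2, h3, h4, h5, fun s hs => h6 s (hJ hs)⟩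

lemma IsPosPowerIntegral.comp_neg {K : ℂ → ℂ} {I : Set ℝ} (h : IsPosPowerIntegral K I) :
    IsPosPowerIntegral (fun s => K (-s)) {σ | -σ ∈ I} := by
  obtain ⟨μ, g, X, h1, h2, h3, h4, h5, h6⟩ := h
  refine ⟨μ, g, fun a => (X a)⁻¹, h1, h2, h3, h4.inv, ?_, fun s hs => ?_⟩
  · filter_upwards [h5] with a ha using ⟨ha.1, inv_pos.2 ha.2⟩
  · have key : (fun a => (g a : ℂ) * (X a : ℂ) ^ (-s)) =ᵐ[μ]
        fun a => (g a : ℂ) * (((X a)⁻¹ : ℝ) : ℂ) ^ s := by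
      filter_upwards [h5] with a ha
      rw [Complex.ofReal_inv, Complex.inv_cpow, Complex.cpow_neg]
      rw [Complex.arg_ofReal_of_nonneg ha.2.le]
      exact Real.pi_pos.ne
    obtain ⟨h7, h8⟩ := h6 (-s) (by simpa using hs)
    exact ⟨h7.congr key, (integral_congr_ae key).symm.trans h8⟩

lemma ofReal_div_cpow_neg {t x : ℝ} (ht : 0 < t) (hx : 0 < x) (s : ℂ) :
    ((t / x : ℝ) : ℂ) ^ (-s) = (t : ℂ) ^ (-s) * (x : ℂ) ^ s := by
  rw [div_eq_mul_inv, Complex.ofReal_mul,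
    Complex.mul_cpow_ofReal_nonneg ht.le (inv_pos.2 hx).le, Complex.ofReal_inv, Complex.inv_cpow,
    Complex.cpow_neg _ s, Complex.cpow_neg, inv_inv]
  rw [Complex.arg_ofReal_of_nonneg hx.le]
  exact Real.pi_pos.ne

/-- The hypothesis needed for Fubini: on a vertical line `|X^s| = X^σ` does not depend on the
height, so the integrand is dominated by a product of two integrable functions. -/
lemma integrable_prod_mul_cpow {K : ℂ → ℂ} {μ : Measure ℝ} [SFinite μ] {g X : ℝ → ℝ}
    (hg : Measurable g) (hX : Measurable X) (hpos : ∀ᵐ a ∂μ, 0 < g a ∧ 0 < X a) {σ t : ℝ}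
    (ht : 0 < t) (hK : Complex.VerticalIntegrable K σ)
    (hi : Integrable (fun a => (g a : ℂ) * (X a : ℂ) ^ (σ : ℂ)) μ) :
    Integrable (fun z : ℝ × ℝ => ((t : ℂ) ^ (-((σ : ℂ) + z.1 * Complex.I)) *
      K (σ + z.1 * Complex.I)) * ((g z.2 : ℂ) * (X z.2 : ℂ) ^ ((σ : ℂ) + z.1 * Complex.I)))
      (volume.prod μ) := by
  have h0 := (Integrable.mul_prod hK hi).norm.const_mul (t ^ (-σ))
  refine h0.mono' ?_ ?_
  · refine AEStronglyMeasurable.mul ?_ ?_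
    · refine AEStronglyMeasurable.mul ?_ hK.aestronglyMeasurable.comp_fst
      exact Measurable.aestronglyMeasurable (by fun_prop)
    · exact Measurable.aestronglyMeasurable (by fun_prop)
  · have : ∀ᵐ z : ℝ × ℝ ∂(volume.prod μ), 0 < g z.2 ∧ 0 < X z.2 :=
      Measure.quasiMeasurePreserving_snd.ae hpos
    filter_upwards [this] with z hz
    simp only [norm_mul, Complex.norm_cpow_eq_rpow_re_of_pos ht,
      Complex.norm_cpow_eq_rpow_re_of_pos hz.2]
    simp [mul_assoc]

/-- Insert the integral for `L`, swap, and use `t^(-s) X^s = (t/X)^(-s)`: the new inverse transform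
is `∫ g F(t/X) dμ`, the same on every line. -/
lemma HasPosMellinInv.mul {K L : ℂ → ℂ} {I : Set ℝ} (hI : I.Nonempty)
    (hK : HasPosMellinInv K I) (hL : IsPosPowerIntegral L I) :
    HasPosMellinInv (fun s => K s * L s) I := by
  obtain ⟨F, hF, hK⟩ := hK
  obtain ⟨μ, g, X, _, hμ, hg, hX, hpos, hL⟩ := hL
  have main : ∀ σ ∈ I, ∀ t : ℝ, 0 < t →
      Integrable (fun a => g a * F (t / X a)) μ ∧
      Integrable (fun y : ℝ => (t : ℂ) ^ (-((σ : ℂ) + y * Complex.I)) *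
        (K (σ + y * Complex.I) * L (σ + y * Complex.I))) ∧
      mellinInv σ (fun s => K s * L s) t = ((∫ a, g a * F (t / X a) ∂μ : ℝ) : ℂ) := by
    intro σ hσ t ht
    obtain ⟨hv, hinv⟩ := hK σ hσ
    have hre : ∀ y : ℝ, ((σ : ℂ) + y * Complex.I).re ∈ I := fun y => by simpa using hσ
    have hint := integrable_prod_mul_cpow hg hX hpos ht hv
      (hL σ (by simpa using hσ)).1
    have e1 : ∀ y : ℝ, ∫ a, ((t : ℂ) ^ (-((σ : ℂ) + y * Complex.I)) *
      K (σ + y * Complex.I)) * ((g a : ℂ) * (X a : ℂ) ^ ((σ : ℂ) + y * Complex.I)) ∂μ =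
        (t : ℂ) ^ (-((σ : ℂ) + y * Complex.I)) *
        (K (σ + y * Complex.I) * L (σ + y * Complex.I)) := fun y => by
      rw [integral_const_mul, (hL _ (hre y)).2, mul_assoc]
    have e2 : ∀ᵐ a ∂μ, ∫ y : ℝ, ((t : ℂ) ^ (-((σ : ℂ) + y * Complex.I)) *
        K (σ + y * Complex.I)) * ((g a : ℂ) * (X a : ℂ) ^ ((σ : ℂ) + y * Complex.I)) =
          (2 * Real.pi) * ((g a * F (t / X a) : ℝ) : ℂ) := by
      filter_upwards [hpos] with a ha
      rw [Complex.ofReal_mul, ← hinv _ (div_pos ht ha.2), mellinInv, Complex.real_smul]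
      simp_rw [ofReal_div_cpow_neg ht ha.2, smul_eq_mul]
      have hpi : (Real.pi : ℂ) ≠ 0 := by exact_mod_cast Real.pi_ne_zero
      push_cast
      rw [← integral_const_mul, ← integral_const_mul, ← integral_const_mul]
      congr 1
      ext y
      field_simp
    have i1 := hint.integral_prod_left
    have i2 := hint.integral_prod_right
    simp only [e1] at i1
    have i3 := (i2.congr e2).const_mul ((2 * Real.pi : ℂ)⁻¹)
    have hpi : (2 * Real.pi : ℂ) ≠ 0 := by exact_mod_cast Real.two_pi_pos.ne'
    simp only [inv_mul_cancel_left₀ hpi] at i3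
    refine ⟨?_, i1, ?_⟩
    · simpa using i3.re
    · rw [mellinInv]
      simp_rw [smul_eq_mul, ← e1]
      rw [integral_integral_swap hint, integral_congr_ae e2, integral_const_mul,
        integral_complex_ofReal, Complex.real_smul]
      push_cast
      field_simp
  obtain ⟨σ₀, hσ₀⟩ := hI
  refine ⟨fun t => ∫ a, g a * F (t / X a) ∂μ, fun t ht => ?_, fun σ hσ => ⟨?_, fun t ht => ?_⟩⟩
  -- An integrand positive almost everywhere has a positive integral because `μ ≠ 0`.
  · have hp : ∀ᵐ a ∂μ, 0 < g a * F (t / X a) := by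
      filter_upwards [hpos] with a ha using mul_pos ha.1 (hF _ (div_pos ht ha.2))
    rw [integral_pos_iff_support_of_nonneg_ae (hp.mono fun a ha => ha.le) (main σ₀ hσ₀ t ht).1,
      pos_iff_ne_zero, ne_eq, measure_eq_zero_iff_ae_notMem]
    intro h
    apply hμ
    rw [← ae_eq_bot, ← Filter.eventually_false_iff_eq_bot]
    filter_upwards [hp, h] with a h1 h2
    exact h2 h1.ne'
  -- At `t = 1` the factor `t^(-s)` disappears.
  · simpa [Complex.VerticalIntegrable] using (main σ hσ 1 one_pos).2.1
  · exact (main σ hσ t ht).2.2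

lemma HasPosMellinInv.mul_list_prod {I : Set ℝ} (hI : I.Nonempty) {K : ℂ → ℂ}
    (hK : HasPosMellinInv K I) (l : List (ℂ → ℂ)) (hl : ∀ L ∈ l, IsPosPowerIntegral L I) :
    HasPosMellinInv (fun s => K s * (l.map (fun L => L s)).prod) I := by
  induction l generalizing K with
  | nil => simpa using hK
  | cons L l ih =>
    simp only [List.map_cons, List.prod_cons, ← mul_assoc]
    exact ih (hK.mul hI (hl L (by simp))) fun M hM => hl M (by simp [hM])

/-! ### Euler and Beta integrals as positive power integrals -/

lemma isPosPowerIntegral_Gamma (b : ℝ) :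
    IsPosPowerIntegral (fun s => Complex.Gamma (b + s)) {σ | 0 < b + σ} := by
  refine ⟨volume.restrict (Set.Ioi 0), fun x => Real.exp (-x) * x ^ (b - 1), fun x => x,
    inferInstance, by simp, by fun_prop, measurable_id, ?_, fun s hs => ?_⟩
  · filter_upwards [ae_restrict_mem measurableSet_Ioi] with x (hx : 0 < x)
    exact ⟨by positivity, hx⟩
  · have key : ∀ x ∈ Set.Ioi (0 : ℝ), ((-x).exp : ℂ) * (x : ℂ) ^ ((b + s) - 1) =
        ((Real.exp (-x) * x ^ (b - 1) : ℝ) : ℂ) * (x : ℂ) ^ s := fun x (hx : 0 < x) => by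
      rw [Complex.ofReal_mul, Complex.ofReal_cpow hx.le, mul_assoc, ← Complex.cpow_add _ _
        (by exact_mod_cast hx.ne')]
      congr 2
      push_cast
      ring
    have hre : 0 < ((b : ℂ) + s).re := by simpa using hs
    refine ⟨(Complex.GammaIntegral_convergent hre).congr_fun key measurableSet_Ioi, ?_⟩
    rw [← setIntegral_congr_fun measurableSet_Ioi key]
    exact (Complex.Gamma_eq_integral hre).symm

/-- The Beta integral: the weight on `(0, 1)` is `x^(c-1) (1-x)^(d-c-1) / Γ(d-c)`, positive as soon
as `c < d`. -/
lemma isPosPowerIntegral_Gamma_div_Gamma {c d : ℝ} (hcd : c < d) :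
    IsPosPowerIntegral (fun s => Complex.Gamma (c + s) / Complex.Gamma (d + s))
      {σ | 0 < c + σ} := by
  refine ⟨volume.restrict (Set.Ioo 0 1),
    fun x => (Real.Gamma (d - c))⁻¹ * (x ^ (c - 1) * (1 - x) ^ (d - c - 1)), fun x => x,
    inferInstance, by simp, by fun_prop, measurable_id, ?_, fun s hs => ?_⟩
  · filter_upwards [ae_restrict_mem measurableSet_Ioo] with x hx
    have h1 := hx.1
    have h2 := sub_pos.2 hx.2
    have h3 := Real.Gamma_pos_of_pos (sub_pos.2 hcd)
    exact ⟨by positivity, hx.1⟩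
  · have key : ∀ x ∈ Set.Ioo (0 : ℝ) 1, ((Real.Gamma (d - c) : ℂ))⁻¹ *
          ((x : ℂ) ^ (((c : ℂ) + s) - 1) * (1 - (x : ℂ)) ^ (((d - c : ℝ) : ℂ) - 1)) =
        (((Real.Gamma (d - c))⁻¹ * (x ^ (c - 1) * (1 - x) ^ (d - c - 1)) : ℝ) : ℂ) *
          (x : ℂ) ^ s := fun x hx => by
      rw [Complex.ofReal_mul, Complex.ofReal_mul, Complex.ofReal_cpow hx.1.le,
        Complex.ofReal_cpow (sub_pos.2 hx.2).le, add_sub_right_comm, Complex.cpow_add _ _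
        (by exact_mod_cast hx.1.ne')]
      push_cast
      ring
    have hre : 0 < ((c : ℂ) + s).re := by simpa using hs
    have hre' : 0 < (((d - c : ℝ) : ℂ)).re := by simpa using hcd
    have hconv := (Complex.betaIntegral_convergent hre hre')
    rw [intervalIntegrable_iff_integrableOn_Ioo_of_le zero_le_one] at hconv
    refine ⟨IntegrableOn.congr_fun (hconv.const_mul _) key measurableSet_Ioo, ?_⟩
    rw [← setIntegral_congr_fun measurableSet_Ioo key, integral_const_mul,
      ← integral_Ioc_eq_integral_Ioo, ← intervalIntegral.integral_of_le zero_le_one]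
    have hb := Complex.Gamma_mul_Gamma_eq_betaIntegral hre hre'
    rw [Complex.betaIntegral] at hb
    have hd : (c : ℂ) + s + ((d - c : ℝ) : ℂ) = d + s := by push_cast; ring
    rw [hd, Complex.Gamma_ofReal] at hb
    have h1 : (Real.Gamma (d - c) : ℂ) ≠ 0 := by
      exact_mod_cast (Real.Gamma_pos_of_pos (sub_pos.2 hcd)).ne'
    have h2 : Complex.Gamma (d + s) ≠ 0 := Complex.Gamma_ne_zero_of_re_pos (by
      have : 0 < c + s.re := hs
      simp only [Complex.add_re, Complex.ofReal_re]
      linarith)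
    field_simp
    rw [mul_comm, ← hb, mul_comm]

/-! ### Mellin inversion for a single Gamma factor -/

lemma norm_Gamma_le_Gamma_re {s : ℂ} (hs : 0 < s.re) :
    ‖Complex.Gamma s‖ ≤ Real.Gamma s.re := by
  rw [Complex.Gamma_eq_integral hs, Real.Gamma_eq_integral hs, Complex.GammaIntegral]
  refine (norm_integral_le_integral_norm _).trans (le_of_eq ?_)
  refine setIntegral_congr_fun measurableSet_Ioi fun x (hx : 0 < x) => ?_
  simp only [norm_mul, Complex.norm_real, Complex.norm_cpow_eq_rpow_re_of_pos hx]
  simp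

/-- Quadratic decay suffices, without Stirling: `Γ(s+2) = (s+1) s Γ(s)` and `|Γ(s+2)| ≤ Γ(σ+2)` give
`|Γ(s)| ≤ Γ(σ+2)/|s|²`. -/
lemma verticalIntegrable_Gamma {σ : ℝ} (hσ : 0 < σ) :
    Complex.VerticalIntegrable Complex.Gamma σ := by
  have hre : ∀ y : ℝ, ((σ : ℂ) + y * Complex.I).re = σ := fun y => by simp
  have hcont : Continuous fun y : ℝ => Complex.Gamma (σ + y * Complex.I) := by
    refine continuous_iff_continuousAt.2 fun y => ?_
    refine ContinuousAt.comp (f := fun y : ℝ => (σ : ℂ) + y * Complex.I)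
      (Complex.differentiableAt_Gamma _ fun m h => ?_).continuousAt (by fun_prop)
    have := congrArg Complex.re h
    rw [hre] at this
    simp only [Complex.neg_re, Complex.natCast_re] at this
    have h2 : (0 : ℝ) ≤ m := m.cast_nonneg
    linarith
  -- This is `Γ(σ+2)/(σ²+y²)`, written to match the integrability of `1/(1+x²)`.
  have hdom : Integrable fun y : ℝ => Real.Gamma (σ + 2) * (σ ^ 2)⁻¹ * (1 + (y * σ⁻¹) ^ 2)⁻¹ :=
    ((integrable_inv_one_add_sq.comp_mul_right' (inv_ne_zero hσ.ne')).const_mul _)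
  refine hdom.mono' hcont.aestronglyMeasurable (Filter.Eventually.of_forall fun y => ?_)
  set s : ℂ := σ + y * Complex.I with hs
  have h0 : s ≠ 0 := fun h => hσ.ne' (by rw [← hre y, ← hs, h, Complex.zero_re])
  have h1 : s + 1 ≠ 0 := fun h => by
    have := congrArg Complex.re h
    simp [hs] at this
    linarith
  have hG : Complex.Gamma (s + 2) = (s + 1) * (s * Complex.Gamma s) := by
    rw [← Complex.Gamma_add_one s h0, ← Complex.Gamma_add_one _ h1]
    congr 1
    ring
  have hn : σ ^ 2 + y ^ 2 = ‖s‖ ^ 2 := by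
    rw [Complex.sq_norm, Complex.normSq_apply]
    simp [hs]
    ring
  have hle : ‖s‖ ≤ ‖s + 1‖ := by
    apply abs_le_of_sq_le_sq' _ (norm_nonneg _) |>.2
    rw [Complex.sq_norm, Complex.sq_norm, Complex.normSq_apply, Complex.normSq_apply]
    simp [hs]
    nlinarith
  have hb : ‖s‖ ^ 2 * ‖Complex.Gamma s‖ ≤ Real.Gamma (σ + 2) := by
    have h2 := norm_Gamma_le_Gamma_re (s := s + 2) (by simp [hs]; linarith)
    rw [hG, norm_mul, norm_mul] at h2
    have h3 : (s + 2).re = σ + 2 := by simp [hs]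
    rw [h3] at h2
    refine le_trans ?_ h2
    rw [← mul_assoc, sq]
    gcongr
  have hrw : Real.Gamma (σ + 2) * (σ ^ 2)⁻¹ * (1 + (y * σ⁻¹) ^ 2)⁻¹ =
      Real.Gamma (σ + 2) / ‖s‖ ^ 2 := by
    rw [← hn]
    field_simp
  rw [hrw, le_div_iff₀ (by positivity), mul_comm]
  exact hb

lemma mellin_rpow_mul_exp_neg (b : ℝ) {s : ℂ} (hs : 0 < b + s.re) :
    MellinConvergent (fun x : ℝ => ((x ^ b * Real.exp (-x) : ℝ) : ℂ)) s ∧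
      mellin (fun x : ℝ => ((x ^ b * Real.exp (-x) : ℝ) : ℂ)) s = Complex.Gamma (b + s) := by
  have key : ∀ x ∈ Set.Ioi (0 : ℝ), ((-x).exp : ℂ) * (x : ℂ) ^ ((b + s) - 1) =
      (x : ℂ) ^ (s - 1) • ((x ^ b * Real.exp (-x) : ℝ) : ℂ) := fun x (hx : 0 < x) => by
    rw [Complex.ofReal_mul, Complex.ofReal_cpow hx.le, add_sub_assoc, Complex.cpow_add _ _
      (by exact_mod_cast hx.ne'), smul_eq_mul]
    ring
  have hre : 0 < ((b : ℂ) + s).re := by simpa using hs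
  refine ⟨(Complex.GammaIntegral_convergent hre).congr_fun key measurableSet_Ioi, ?_⟩
  rw [mellin, ← setIntegral_congr_fun measurableSet_Ioi key, Complex.Gamma_eq_integral hre]
  rfl

lemma hasPosMellinInv_Gamma (b : ℝ) {I : Set ℝ} (hI : ∀ σ ∈ I, 0 < b + σ) :
    HasPosMellinInv (fun s => Complex.Gamma (b + s)) I := by
  refine ⟨fun x => x ^ b * Real.exp (-x), fun t ht => by positivity, fun σ hσ => ?_⟩
  have hm : ∀ y : ℝ, mellin (fun x : ℝ => ((x ^ b * Real.exp (-x) : ℝ) : ℂ))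
      (σ + y * Complex.I) = Complex.Gamma (b + (σ + y * Complex.I)) := fun y =>
    (mellin_rpow_mul_exp_neg b (by simpa using hI σ hσ)).2
  have hv : Complex.VerticalIntegrable (fun s => Complex.Gamma (b + s)) σ := by
    have := verticalIntegrable_Gamma (hI σ hσ)
    simpa [Complex.VerticalIntegrable, add_assoc] using this
  refine ⟨hv, fun t ht => ?_⟩
  rw [← mellinInv_mellin_eq σ (fun x : ℝ => ((x ^ b * Real.exp (-x) : ℝ) : ℂ)) ht
    (mellin_rpow_mul_exp_neg b (by simpa using hI σ hσ)).1]
  · simp only [mellinInv, hm]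
  · simpa only [Complex.VerticalIntegrable, hm] using hv
  · refine Complex.continuous_ofReal.continuousAt.comp ?_
    exact (Real.continuousAt_rpow_const _ _ (Or.inl ht.ne')).mul (by fun_prop)

/-! ### Mellin–Barnes integrals as inverse Mellin transforms -/

lemma mellinBarnesIntegral_eq_mellinInv (m n : ℕ) {p q : ℕ} (α : Fin p → ℂ) (A : Fin p → ℝ)
    (β : Fin q → ℂ) (B : Fin q → ℝ) (t γ : ℝ) :
    mellinBarnesIntegral m n α A β B t γ = mellinInv γ (foxKernel m n α A β B) t := by
  simp only [mellinBarnesIntegral, mellinBarnesIntegrand, mellinInv, smul_eq_mul,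
    Complex.real_smul]
  rw [integral_mul_const]
  have hpi : (Real.pi : ℂ) ≠ 0 := by exact_mod_cast Real.pi_ne_zero
  simp_rw [mul_comm (foxKernel m n α A β B _)]
  push_cast
  field_simp

/-- The positive function is common to all separating lines, so the line chosen in `foxH` does not
matter. -/
lemma foxH_exists_and_pos {m n p q : ℕ} {α : Fin p → ℂ} {A : Fin p → ℝ}
    {β : Fin q → ℂ} {B : Fin q → ℝ} (hne : ∃ γ : ℝ, SeparatesPoles m n α A β B γ)
    (h : HasPosMellinInv (foxKernel m n α A β B) {γ | SeparatesPoles m n α A β B γ})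
    {t : ℝ} (ht : 0 < t) :
    FoxHExists m n α A β B t ∧ ∃ x : ℝ, 0 < x ∧ foxH m n α A β B t = x := by
  obtain ⟨F, hF, h⟩ := h
  have hval : ∀ γ, SeparatesPoles m n α A β B γ → mellinBarnesIntegral m n α A β B t γ = F t :=
    fun γ hγ => by rw [mellinBarnesIntegral_eq_mellinInv, (h γ hγ).2 t ht]
  have hH : foxH m n α A β B t = F t := by
    rw [foxH, dif_pos hne]
    exact hval _ hne.choose_spec
  refine ⟨⟨hne, fun γ hγ => ⟨?_, by rw [hval γ hγ, hH]⟩⟩, F t, hF t ht, hH⟩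
  have hK := (h γ hγ).1
  refine (hK.norm.const_mul (t ^ (-γ))).mono' ?_ (Filter.Eventually.of_forall fun y => ?_)
  · refine AEStronglyMeasurable.mul hK.aestronglyMeasurable ?_
    exact Measurable.aestronglyMeasurable (by fun_prop)
  · rw [mellinBarnesIntegrand, norm_mul, Complex.norm_cpow_eq_rpow_re_of_pos ht, mul_comm]
    simp

/-! ### Kernel and separating lines in terms of parameter lists -/

lemma prod_filter_val_lt_eq_take {M R : Type*} [CommMonoid M] {q : ℕ} (β : Fin q → R) (f : R → M)
    (m : ℕ) : ∏ j ∈ Finset.univ.filter (fun j : Fin q => (j : ℕ) < m), f (β j) =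
      (((List.ofFn β).take m).map f).prod := by
  rw [List.map_take, List.map_ofFn, List.prod_take_ofFn]
  rfl

lemma prod_filter_le_val_eq_drop {M R : Type*} [CommMonoid M] {q : ℕ} (β : Fin q → R) (f : R → M)
    (m : ℕ) : ∏ j ∈ Finset.univ.filter (fun j : Fin q => m ≤ (j : ℕ)), f (β j) =
      (((List.ofFn β).drop m).map f).prod := by
  rw [Finset.prod_filter]
  induction q generalizing m with
  | zero => simp
  | succ q ih =>
    rw [Fin.prod_univ_succ, List.ofFn_succ]
    cases m with
    | zero =>
      have := ih (fun j => β j.succ) 0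
      simp_all
    | succ m =>
      have := ih (fun j => β j.succ) m
      simp_all

lemma forall_mem_take_ofFn {R : Type*} {q : ℕ} (β : Fin q → R) (m : ℕ) (P : R → Prop) :
    (∀ x ∈ (List.ofFn β).take m, P x) ↔ ∀ j : Fin q, (j : ℕ) < m → P (β j) := by
  simp only [List.mem_take_iff_getElem, List.getElem_ofFn, List.length_ofFn, lt_min_iff]
  constructor
  · intro h j hj
    exact h _ ⟨j, ⟨hj, j.2⟩, rfl⟩
  · rintro h _ ⟨i, hi, rfl⟩
    exact h _ hi.1

/-- In each sequence of poles the one with `l = 0` is nearest to the line, so it alone matters. -/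
lemma separatesPoles_one_iff {m n p q : ℕ} (α : Fin p → ℝ) (β : Fin q → ℝ) (γ : ℝ) :
    SeparatesPoles m n (fun j => (α j : ℂ)) (fun _ => 1) (fun j => (β j : ℂ)) (fun _ => 1) γ ↔
      (∀ x ∈ (List.ofFn β).take m, 0 < x + γ) ∧ ∀ x ∈ (List.ofFn α).take n, γ < 1 - x := by
  rw [forall_mem_take_ofFn, forall_mem_take_ofFn, SeparatesPoles]
  simp only [Complex.ofReal_one, div_one]
  refine and_congr (forall₂_congr fun j _ => ⟨fun h => ?_, fun h l => ?_⟩)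
    (forall₂_congr fun j _ => ⟨fun h => ?_, fun h l => ?_⟩)
  · have := h 0
    simp at this
    linarith
  · have : (0 : ℝ) ≤ l := l.cast_nonneg
    simp
    linarith
  · simpa using h 0
  · have : (0 : ℝ) ≤ l := l.cast_nonneg
    simp
    linarith

lemma foxKernel_one_eq {m n p q : ℕ} (α : Fin p → ℝ) (β : Fin q → ℝ) (s : ℂ) :
    foxKernel m n (fun j => (α j : ℂ)) (fun _ => 1) (fun j => (β j : ℂ)) (fun _ => 1) s =
      ((((List.ofFn β).take m).map fun x : ℝ => Complex.Gamma (x + s)).prod *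
        (((List.ofFn α).take n).map fun x : ℝ => Complex.Gamma (1 - x - s)).prod) /
      ((((List.ofFn β).drop m).map fun x : ℝ => Complex.Gamma (1 - x - s)).prod *
        (((List.ofFn α).drop n).map fun x : ℝ => Complex.Gamma (x + s)).prod) := by
  simp only [foxKernel, Complex.ofReal_one, one_mul, ← prod_filter_val_lt_eq_take,
    ← prod_filter_le_val_eq_drop]

/-! ### Assembling the kernel from its factors -/

lemma exists_pos_forall_mem_lt (l : List ℝ) (hl : ∀ x ∈ l, 0 < x) :
    ∃ γ > 0, ∀ x ∈ l, γ < x := by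
  induction l with
  | nil => exact ⟨1, one_pos, by simp⟩
  | cons a l ih =>
    obtain ⟨γ, h0, h⟩ := ih fun x hx => hl x (by simp [hx])
    have ha := hl a (by simp)
    refine ⟨min γ (a / 2), by positivity, fun x hx => ?_⟩
    rcases List.mem_cons.1 hx with rfl | hx
    · exact (min_le_right _ _).trans_lt (half_lt_self ha)
    · exact (min_le_left _ _).trans_lt (h x hx)

lemma hasPosMellinInv_prod_Gamma {I : Set ℝ} (hI : I.Nonempty) {l : List ℝ} (hl : l ≠ [])
    (hlI : ∀ b ∈ l, ∀ σ ∈ I, 0 < b + σ) :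
    HasPosMellinInv (fun s => (l.map fun b : ℝ => Complex.Gamma (b + s)).prod) I := by
  obtain ⟨b, l, rfl⟩ := List.exists_cons_of_ne_nil hl
  have := (hasPosMellinInv_Gamma b (hlI b (by simp))).mul_list_prod hI
    (l.map fun (b : ℝ) (s : ℂ) => Complex.Gamma (b + s)) (by
      simp only [List.mem_map]
      rintro _ ⟨c, hc, rfl⟩
      exact (isPosPowerIntegral_Gamma c).mono fun σ hσ => hlI c (by simp [hc]) σ hσ)
  simpa [List.map_map, Function.comp_def] using this

/-- A common shift only translates the strip of separating lines; the inequalities `c < d` and `v <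
w` behind the Beta integrals are unchanged, so the sign of `ε` is irrelevant. -/
lemma meijerG_exists_and_pos_of_shift {m n p q : ℕ} {α : Fin p → ℝ} {β : Fin q → ℝ} {lam : ℝ}
    (hep : EPConditions m n α (fun _ => lam) β (fun _ => lam)) (ε : ℝ) {t : ℝ} (ht : 0 < t) :
    MeijerGExists m n (fun j => ((α j + ε : ℝ) : ℂ)) (fun j => ((β j + ε : ℝ) : ℂ)) t ∧
      ∃ x : ℝ, 0 < x ∧
        meijerG m n (fun j => ((α j + ε : ℝ) : ℂ)) (fun j => ((β j + ε : ℝ) : ℂ)) t = x := by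
  obtain ⟨n₁, n₂, n₃, n₄, a₁, b, a₂, c, d, a₃, o, r, a₄, v, w, h1, h2, h3, h4,
    ⟨hm, hn, -, -⟩, hne, hα, hβ, -⟩ := hep
  have hα' : List.ofFn (fun j => α j + ε) = (List.ofFn (fun j => 1 - r j + ε) ++
      List.ofFn (fun j => 1 - v j + ε)) ++ List.ofFn (fun j => d j + ε) := by
    simpa [List.map_ofFn, Function.comp_def] using congrArg (List.map fun x => x.1 + ε) hα
  have hβ' : List.ofFn (fun j => β j + ε) = (List.ofFn (fun j => b j + ε) ++
      List.ofFn (fun j => c j + ε) ++ List.ofFn (fun j => o j + ε)) ++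
      List.ofFn (fun j => 1 - w j + ε) := by
    simpa [List.map_ofFn, Function.comp_def] using congrArg (List.map fun x => x.1 + ε) hβ
  have hsep : ∀ γ : ℝ, SeparatesPoles m n (fun j => ((α j + ε : ℝ) : ℂ)) (fun _ => 1)
      (fun j => ((β j + ε : ℝ) : ℂ)) (fun _ => 1) γ ↔
      ((∀ j, 0 < b j + ε + γ) ∧ (∀ j, 0 < c j + ε + γ) ∧ ∀ j, 0 < o j + ε + γ) ∧
        (∀ j, γ < r j - ε) ∧ ∀ j, γ < v j - ε := fun γ => by
    rw [separatesPoles_one_iff, hα', hβ', List.take_left' (by simp [hm, add_assoc]),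
      List.take_left' (by simp [hn])]
    simp only [List.forall_mem_append, List.forall_mem_ofFn_iff, and_assoc]
    simp only [sub_add_eq_sub_sub, sub_sub_cancel]
  have hexists : ∃ γ : ℝ, SeparatesPoles m n (fun j => ((α j + ε : ℝ) : ℂ)) (fun _ => 1)
      (fun j => ((β j + ε : ℝ) : ℂ)) (fun _ => 1) γ := by
    obtain ⟨γ, h0, hγ⟩ := exists_pos_forall_mem_lt (List.ofFn r ++ List.ofFn v) (by
      simp only [List.forall_mem_append, List.forall_mem_ofFn_iff]
      exact ⟨fun j => (h3 j).2.1, fun j => (h4 j).2.1⟩)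
    simp only [List.forall_mem_append, List.forall_mem_ofFn_iff] at hγ
    -- `γ` lies strictly between `0` and all `r j`, `v j`, hence separates the unshifted poles, as
    -- `b, c, o ≥ 0`; the shift by `ε` moves it to `γ - ε`.
    refine ⟨γ - ε, (hsep _).2 ⟨⟨fun j => ?_, fun j => ?_, fun j => ?_⟩, fun j => ?_, fun j => ?_⟩⟩
    · linarith [(h1 j).2]
    · linarith [(h2 j).2.1]
    · linarith [(h3 j).2.2]
    · linarith [hγ.1 j]
    · linarith [hγ.2 j]
  refine foxH_exists_and_pos hexists ?_ ht
  have hI : {γ : ℝ | SeparatesPoles m n (fun j => ((α j + ε : ℝ) : ℂ)) (fun _ => 1)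
      (fun j => ((β j + ε : ℝ) : ℂ)) (fun _ => 1) γ}.Nonempty := hexists
  -- The induction needs one factor `Γ(b+ε+s)` or `Γ(o+ε+s)` to start from; `n₁ ≥ 1` or `n₃ ≥ 1`
  -- provides it.
  have hbase := hasPosMellinInv_prod_Gamma hI
    (l := List.ofFn (fun j => b j + ε) ++ List.ofFn (fun j => o j + ε))
    (by
      simp only [ne_eq, List.append_eq_nil_iff, List.ofFn_eq_nil_iff]
      omega)
    (by
      simp only [List.forall_mem_append, List.forall_mem_ofFn_iff]
      exact ⟨fun j σ hσ => ((hsep σ).1 hσ).1.1 j, fun j σ hσ => ((hsep σ).1 hσ).1.2.2 j⟩)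
  have hfull := hbase.mul_list_prod hI
    ((List.ofFn fun (j : Fin n₂) (s : ℂ) =>
        Complex.Gamma ((c j + ε : ℝ) + s) / Complex.Gamma ((d j + ε : ℝ) + s)) ++
      (List.ofFn fun (j : Fin n₃) (s : ℂ) => Complex.Gamma ((r j - ε : ℝ) + -s)) ++
      (List.ofFn fun (j : Fin n₄) (s : ℂ) =>
        Complex.Gamma ((v j - ε : ℝ) + -s) / Complex.Gamma ((w j - ε : ℝ) + -s))) (by
    simp only [List.forall_mem_append, List.forall_mem_ofFn_iff]
    refine ⟨⟨fun j => ?_, fun j => ?_⟩, fun j => ?_⟩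
    · exact (isPosPowerIntegral_Gamma_div_Gamma (by linarith [(h2 j).2.2])).mono
        fun σ hσ => ((hsep σ).1 hσ).1.2.1 j
    · refine (isPosPowerIntegral_Gamma (r j - ε)).comp_neg.mono fun σ hσ => ?_
      have := ((hsep σ).1 hσ).2.1 j
      simpa using this
    · refine (isPosPowerIntegral_Gamma_div_Gamma (c := v j - ε) (d := w j - ε)
        (by linarith [(h4 j).2.2])).comp_neg.mono fun σ hσ => ?_
      have := ((hsep σ).1 hσ).2.2 j
      simpa using this)
  convert hfull using 2 with s
  rw [foxKernel_one_eq, hα', hβ', List.take_left' (by simp [hm, add_assoc]),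
    List.take_left' (by simp [hn]), List.drop_left' (by simp [hm, add_assoc]),
    List.drop_left' (by simp [hn])]
  -- Parameters listed as `1 - r`, `1 - v`, `1 - w` enter the kernel through `1 - · - s`, which
  -- undoes the reflection.
  have hrefl : ∀ x : ℝ, Complex.Gamma (1 - ((1 - x + ε : ℝ) : ℂ) - s) =
      Complex.Gamma ((x - ε : ℝ) + -s) := fun x => by
    congr 1
    push_cast
    ring
  simp only [List.map_append, List.map_ofFn, List.prod_append, List.prod_ofFn, Function.comp_def,
    hrefl, div_eq_mul_inv, mul_inv, Finset.prod_mul_distrib, Finset.prod_inv_distrib]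
  ring

/-- Under the e.p. conditions with all scale parameters equal to `lam`, the Meijer `G`-functions
with all parameters shifted by `+ω`, or all shifted by `-ω`, exist and are positive reals. -/
theorem corollary9 (m n p q : ℕ) (α : Fin p → ℝ) (β : Fin q → ℝ) (lam : ℝ) (hlam : 0 < lam)
    (hep : EPConditions m n α (fun _ => lam) β (fun _ => lam))
    (ω : ℝ) (hω : 0 < ω) (t : ℝ) (ht : 0 < t) :
    (MeijerGExists m n (fun j => ((α j + ω : ℝ) : ℂ)) (fun j => ((β j + ω : ℝ) : ℂ)) t ∧
      ∃ x : ℝ, 0 < x ∧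
        meijerG m n (fun j => ((α j + ω : ℝ) : ℂ)) (fun j => ((β j + ω : ℝ) : ℂ)) t = x) ∧
    (MeijerGExists m n (fun j => ((α j - ω : ℝ) : ℂ)) (fun j => ((β j - ω : ℝ) : ℂ)) t ∧
      ∃ x : ℝ, 0 < x ∧
        meijerG m n (fun j => ((α j - ω : ℝ) : ℂ)) (fun j => ((β j - ω : ℝ) : ℂ)) t = x) := by
  -- Subtraction of `ω` unfolds to addition of `-ω`.
  exact ⟨meijerG_exists_and_pos_of_shift hep ω ht, meijerG_exists_and_pos_of_shift hep (-ω) ht⟩
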